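/- Let $\mathcal N$ be a finite set of players, each player $k$ having a finite non-empty action set $S_k$, and let the players be the vertices of an undirected network without self-loops. For every ordered pair $(k,l)$ of adjacent players let $A^{kl}$ be a real $|S_k|\times|S_l|$ payoff matrix. For a joint mixed strategy $x=(x_k)_k\in\Delta=\prod_k\Delta(S_k)$, where $\Delta(S_k)$ is the probability simplex over $S_k$, player $k$ receives the payoff $u_k(x)=\sum_{l:(k,l)\in\mathcal E}x_k\cdot A^{kl}x_l$, with $\mathcal E$ the set of ordered pairs of adjacent players; put $r_{ki}(x)=\partial u_k/\partial x_{ki}=\sum_{l:(k,l)\in\mathcal E}(A^{kl}x_l)_i$. Let $\delta_S=\max_{(k,l)\in\mathcal E}\|A^{kl}+(A^{lk})^\top\|_2$ (operator $2$-norm; $\delta_S=0$ if there are no edges). Given exploration rates $T_k>0$, a quantal response equilibrium (QRE) is a point $\bar x\in\Delta$ with $$\bar x_{ki}=\frac{\exp(r_{ki}(\bar x)/T_k)}{\sum_{j\in S_k}\exp(r_{kj}(\bar x)/T_k)}\qquad\text{for all } k \text{ and all } i\in S_k,$$ and the Q-learning dynamics are the differential equation $$\dot x_{ki}=x_{ki}\Big(r_{ki}(x)-\langle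 x_k,r_k(x)\rangle+T_k\sum_{j\in S_k}x_{kj}\ln\frac{x_{kj}}{x_{ki}}\Big)$$ on the set of $x\in\Delta$ all of whose entries are positive. Suppose that the game is pairwise zero-sum, i.e. $A^{kl}+(A^{lk})^\top=0$ for all $(k,l)\in\mathcal E$. Then $\delta_S=0$. Moreover, for all exploration rates $T_k>0$ the game has exactly one QRE $\bar x$, and the Q-learning dynamics converge to $\bar x$: from every initial strategy in $\Delta$ with positive entries there is a solution for all $t\ge 0$, and every solution $x(t)$, $t\ge0$, satisfies $x(t)\to\bar x$ as $t\to\infty$. -/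

import Mathlib

open scoped Matrix Topology Matrix.Norms.L2Operator

/-- A network polymatrix game with player set `V` and action sets `S k`: an undirected network
on the players and a payoff matrix `A k l` for every ordered pair of players. Only the matrices on
edges of the network enter the definitions below. -/
structure NetworkGame (V : Type*) (S : V → Type*) where
  /-- the network -/
  graph : SimpleGraph V
  /-- the payoff matrices -/
  A : (k l : V) → Matrix (S k) (S l) ℝ

namespace NetworkGame

/-- Real vectors indexed by players and their actions (joint strategies live here). -/
abbrev Profile {V : Type*} (S : V → Type*) : Type _ := (k : V) → S k → ℝ

/-- The set `Δ` of joint mixed strategies: the product of the simplices over the action sets. -/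
def strategies {V : Type*} (S : V → Type*) [∀ k, Fintype (S k)] : Set (Profile S) :=
  {x | ∀ k, x k ∈ stdSimplex ℝ (S k)}

/-- The joint mixed strategies in which every action has positive probability. -/
def interiorStrategies {V : Type*} (S : V → Type*) [∀ k, Fintype (S k)] : Set (Profile S) :=
  {x | x ∈ strategies S ∧ ∀ k i, 0 < x k i}

variable {V : Type*} [Fintype V] {S : V → Type*} [∀ k, Fintype (S k)]

open Classical in
/-- The payoff `u_k(x) = ∑_{l : (k,l) ∈ E} x_k · A^{kl} x_l`. -/
noncomputable def payoff (Γ : NetworkGame V S) (k : V) (x : Profile S) : ℝ :=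
  ∑ l with Γ.graph.Adj k l, x k ⬝ᵥ (Γ.A k l *ᵥ x l)

open Classical in
/-- The reward `r_{ki}(x) = ∂u_k/∂x_{ki} = ∑_{l : (k,l) ∈ E} (A^{kl} x_l)_i`
(see `hasDerivAt_payoff`). -/
noncomputable def reward (Γ : NetworkGame V S) (x : Profile S) : Profile S :=
  fun k i => ∑ l with Γ.graph.Adj k l, (Γ.A k l *ᵥ x l) i

theorem payoff_eq_dotProduct_reward (Γ : NetworkGame V S) (k : V) (x : Profile S) :
    Γ.payoff k x = x k ⬝ᵥ Γ.reward x k := by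
  classical
  simp only [payoff, reward, dotProduct, Finset.mul_sum]
  rw [Finset.sum_comm]

open Classical in
/-- The reward is the partial derivative of the payoff in the player's own coordinate. -/
theorem hasDerivAt_payoff (Γ : NetworkGame V S) (k : V) (i : S k) (x : Profile S) :
    HasDerivAt (fun s : ℝ => Γ.payoff k (Function.update x k (Function.update (x k) i s)))
      (Γ.reward x k i) (x k i) := by
  have hr : ∀ s : ℝ, Γ.reward (Function.update x k (Function.update (x k) i s)) k
      = Γ.reward x k := by
    intro s
    funext j
    unfold reward
    refine Finset.sum_congr rfl fun l hl => ?_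
    have hne : l ≠ k := (Finset.mem_filter.1 hl).2.ne'
    rw [Function.update_of_ne hne]
  have h : ∀ s : ℝ, Γ.payoff k (Function.update x k (Function.update (x k) i s))
      = ∑ j, Function.update (x k) i s j * Γ.reward x k j := by
    intro s
    rw [payoff_eq_dotProduct_reward, hr, Function.update_self]
    rfl
  simp only [h]
  have hd : HasDerivAt (fun s : ℝ => ∑ j, Function.update (x k) i s j * Γ.reward x k j)
      (∑ j, (if j = i then 1 else 0) * Γ.reward x k j) (x k i) := by
    refine HasDerivAt.fun_sum fun j _ => HasDerivAt.mul_const ?_ _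
    by_cases hj : j = i
    · subst hj
      simpa using hasDerivAt_id' (x k j)
    · simpa [Function.update_of_ne hj, hj] using hasDerivAt_const (x k i) (x k j)
  simpa using hd

/-- Quantal response equilibria for the exploration rates `T`. -/
def IsQRE (Γ : NetworkGame V S) (T : V → ℝ) (x : Profile S) : Prop :=
  x ∈ strategies S ∧ ∀ k i,
    x k i = Real.exp (Γ.reward x k i / T k) / ∑ j, Real.exp (Γ.reward x k j / T k)

/-- The vector field of the Q-learning dynamics, i.e. the right-hand side of
`ẋ_{ki} = x_{ki} (r_{ki}(x) - ⟨x_k, r_k(x)⟩ + T_k ∑_j x_{kj} ln (x_{kj} / x_{ki}))`. -/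
noncomputable def qLearningField (Γ : NetworkGame V S) (T : V → ℝ) (x : Profile S) : Profile S :=
  fun k i => x k i * (Γ.reward x k i - x k ⬝ᵥ Γ.reward x k
    + T k * ∑ j, x k j * Real.log (x k j / x k i))

/-- A trajectory of the Q-learning dynamics on `[0, ∞)`: the equation involves `ẋ_{ki} / x_{ki}`
and `ln (x_{kj} / x_{ki})`, so its state space consists of the strategies with positive entries. -/
def IsQLearningTrajectory (Γ : NetworkGame V S) (T : V → ℝ) (x : ℝ → Profile S) : Prop :=
  (∀ t, 0 ≤ t → x t ∈ interiorStrategies S) ∧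
    IsIntegralCurveOn x (fun _ => Γ.qLearningField T) (Set.Ici 0)

/-- The Q-learning dynamics converge to `z`: from every initial strategy with positive entries there
is a trajectory for all times `t ≥ 0`, and every trajectory tends to `z` as `t → ∞`. -/
def QLearningConvergesTo (Γ : NetworkGame V S) (T : V → ℝ) (z : Profile S) : Prop :=
  (∀ x₀ ∈ interiorStrategies S, ∃ x, Γ.IsQLearningTrajectory T x ∧ x 0 = x₀) ∧
    ∀ x, Γ.IsQLearningTrajectory T x → Filter.Tendsto x Filter.atTop (𝓝 z)

open Classical in
/-- The interaction coefficient `δ_S`: the maximum over the (ordered) edges `(k, l)` of the operator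
2-norm of `A^{kl} + (A^{lk})ᵀ`; it is `0` if the network has no edges. -/
noncomputable def interactionCoefficient (Γ : NetworkGame V S) : ℝ :=
  ⨆ e : Γ.graph.Dart, ‖Γ.A e.fst e.snd + (Γ.A e.snd e.fst)ᵀ‖

/-- Pairwise zero-sum games: `A^{kl} + (A^{lk})ᵀ = 0` on every edge. -/
def IsPairwiseZeroSum (Γ : NetworkGame V S) : Prop :=
  ∀ k l, Γ.graph.Adj k l → Γ.A k l + (Γ.A l k)ᵀ = 0

end NetworkGame

/-! Pairwise zero-sum payoffs make the form `∑ k, x k ⬝ᵥ Γ.reward y k` antisymmetric in `x` and `y`;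
everything beyond existence of trajectories rests on this.

Existence of a QRE: adding entropies weighted by `T` gives an antisymmetric convex-concave game on a
compact convex set. Sion's theorem provides an optimal strategy, and testing it against its own
logit response forces a weighted sum of relative entropies to vanish, so the two coincide.

Convergence: for a QRE `z`, antisymmetry and the logit form of `z` eliminate the rewards from the
derivative of the relative entropy of `z` with respect to `x t`. What remains is minus a
`T`-weighted symmetrized relative entropy, so the decay is exponential; relative entropy dominates
squared Hellinger distance, hence `x t` tends to `z`. Uniqueness follows, since any other QRE is a
rest point.

Trajectories exist globally because in logarithmic scores the dynamics become a `C¹` field of linear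
growth. -/

open Set Manifold in
/-- An autonomous `C¹` vector field of linear growth has global integral curves. -/
theorem exists_isIntegralCurve_of_norm_le {E : Type*} [NormedAddCommGroup E] [NormedSpace ℝ E]
    [ProperSpace E] {v : E → E} (hv : ContDiff ℝ 1 v) {C M : ℝ} (hC : 0 ≤ C) (hM : 0 ≤ M)
    (hb : ∀ y, ‖v y‖ ≤ C + M * ‖y‖) (y₀ : E) :
    ∃ y : ℝ → E, y 0 = y₀ ∧ IsIntegralCurve y (fun _ => v) := by
  have hε : (0 : ℝ) < 1 / (M + 1) := by positivity
  have hlocal : ∀ x : E, ∃ γ : ℝ → E, γ 0 = x ∧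
      IsMIntegralCurveOn (I := 𝓘(ℝ, E)) γ v (Ioo (-(1 / (M + 1))) (1 / (M + 1))) := by
    intro x
    -- With this radius the speed on the ball is at most `C + M * (‖x‖ + a) = a * (M + 1)`, so the
    -- curve stays inside for time `1 / (M + 1)`. This time does not depend on `x`, which is what
    -- allows local curves to be extended indefinitely.
    set a : ℝ := C + M * ‖x‖ with ha
    have ha0 : 0 ≤ a := by positivity
    obtain ⟨K, hK⟩ := hv.contDiffOn.exists_lipschitzOnWith one_ne_zero
      (convex_closedBall x a) (isCompact_closedBall x a)
    have hL : ∀ y ∈ Metric.closedBall x a, ‖v y‖ ≤ a * (M + 1) := by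
      intro y hy
      have hyx : ‖y‖ ≤ ‖x‖ + a := by
        have := norm_le_norm_add_norm_sub' y x
        rw [mem_closedBall_iff_norm] at hy
        linarith
      have := mul_le_mul_of_nonneg_left hyx hM
      linarith [hb y]
    have hpl : IsPicardLindelof (fun _ => v) (tmin := -(1 / (M + 1))) (tmax := 1 / (M + 1))
        ⟨0, by linarith, hε.le⟩ x ⟨a, ha0⟩ 0 ⟨a * (M + 1), by positivity⟩ K := by
      refine IsPicardLindelof.of_time_independent hL hK ?_
      have h : a * (M + 1) * max (1 / (M + 1) - 0) (0 - -(1 / (M + 1))) ≤ a - 0 := by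
        simp only [sub_zero, zero_sub, neg_neg, max_self]
        exact le_of_eq (by field_simp)
      exact h
    obtain ⟨γ, hγ0, hγ⟩ := hpl.exists_eq_forall_mem_Icc_hasDerivWithinAt₀
    refine ⟨γ, hγ0, fun t ht => ?_⟩
    exact hasMFDerivWithinAt_iff_hasFDerivWithinAt.2
      ((hγ t (Ioo_subset_Icc_self ht)).mono Ioo_subset_Icc_self).hasFDerivWithinAt
  obtain ⟨γ, hγ0, hγ⟩ := exists_isMIntegralCurve_of_isMIntegralCurveOn (I := 𝓘(ℝ, E)) (v := v)
    (contMDiff_vectorSpace_iff_contDiff.2 hv) hε hlocal y₀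
  refine ⟨γ, hγ0, fun t => ?_⟩
  have h : HasFDerivAt γ (ContinuousLinearMap.smulRight (1 : ℝ →L[ℝ] ℝ) (v (γ t))) t :=
    hasMFDerivAt_iff_hasFDerivAt.1 (hγ t)
  simpa using h.hasDerivAt

/-! ### Relative entropy and Hellinger distance -/

theorem sq_sqrt_sub_sqrt_le {a b : ℝ} (ha : 0 ≤ a) (hb : 0 < b) :
    (√a - √b) ^ 2 ≤ a * (Real.log a - Real.log b) - a + b := by
  rcases ha.eq_or_lt with rfl | ha
  · simp [Real.sq_sqrt hb.le]
  · have hsa := Real.sqrt_pos.2 ha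
    have hsb := Real.sqrt_pos.2 hb
    -- Applying `log u ≤ u - 1` at a ratio of square roots, rather than at `b / a`, is what leaves a
    -- perfect square.
    have h := Real.log_le_sub_one_of_pos (div_pos hsb hsa)
    rw [Real.log_div hsb.ne' hsa.ne', Real.log_sqrt hb.le, Real.log_sqrt ha.le] at h
    have h2 := mul_le_mul_of_nonneg_left h ha.le
    have h3 : a * (√b / √a - 1) = √a * √b - a := by
      have : a / √a = √a := Real.div_sqrt
      rw [mul_sub, mul_one, mul_div_assoc', mul_div_right_comm, this]
    nlinarith [Real.sq_sqrt ha.le, Real.sq_sqrt hb.le]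

/-- The relative entropy (Kullback-Leibler divergence) of two vectors. -/
noncomputable def relEntropy {ι : Type*} [Fintype ι] (p q : ι → ℝ) : ℝ :=
  ∑ i, p i * (Real.log (p i) - Real.log (q i))

/-- The relative entropy of two probability vectors dominates the squared Hellinger distance. -/
theorem sum_sq_sqrt_sub_sqrt_le_relEntropy {ι : Type*} [Fintype ι] {p q : ι → ℝ}
    (hp : p ∈ stdSimplex ℝ ι) (hq : q ∈ stdSimplex ℝ ι) (hq' : ∀ i, 0 < q i) :
    ∑ i, (√(p i) - √(q i)) ^ 2 ≤ relEntropy p q := by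
  calc ∑ i, (√(p i) - √(q i)) ^ 2
      ≤ ∑ i, (p i * (Real.log (p i) - Real.log (q i)) - p i + q i) :=
        Finset.sum_le_sum fun i _ => sq_sqrt_sub_sqrt_le (hp.1 i) (hq' i)
    _ = relEntropy p q := by
        rw [relEntropy, Finset.sum_add_distrib, Finset.sum_sub_distrib, hp.2, hq.2]; ring

theorem relEntropy_nonneg {ι : Type*} [Fintype ι] {p q : ι → ℝ}
    (hp : p ∈ stdSimplex ℝ ι) (hq : q ∈ stdSimplex ℝ ι) (hq' : ∀ i, 0 < q i) :
    0 ≤ relEntropy p q :=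
  (Finset.sum_nonneg fun _ _ => sq_nonneg _).trans (sum_sq_sqrt_sub_sqrt_le_relEntropy hp hq hq')

theorem relEntropy_eq_sub {ι : Type*} [Fintype ι] (p q : ι → ℝ) :
    relEntropy p q = ∑ i, p i * Real.log (p i) - ∑ i, p i * Real.log (q i) := by
  simp only [relEntropy, mul_sub, Finset.sum_sub_distrib]

/-! ### Strategies, the logit map and antisymmetry of the rewards -/

namespace NetworkGame

variable {V : Type*} {S : V → Type*} [∀ k, Fintype (S k)]

theorem isCompact_strategies : IsCompact (strategies S) := by
  have : strategies S = Set.univ.pi fun k => stdSimplex ℝ (S k) := by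
    ext x; simp [strategies]
  rw [this]
  exact isCompact_univ_pi fun k => isCompact_stdSimplex ℝ (S k)

theorem convex_strategies : Convex ℝ (strategies S) :=
  fun _ hx _ hy _ _ ha hb hab k => convex_stdSimplex ℝ (S k) (hx k) (hy k) ha hb hab

theorem IsPairwiseZeroSum.interactionCoefficient_eq_zero {Γ : NetworkGame V S}
    (hΓ : Γ.IsPairwiseZeroSum) : Γ.interactionCoefficient = 0 := by
  classical
  -- A real supremum over an empty index type is `0`, so an edgeless network needs no separate case.
  refine (iSup_congr fun e => ?_).trans Real.iSup_const_zero
  rw [hΓ _ _ e.adj]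
  exact norm_zero (E := Matrix (S e.fst) (S e.snd) ℝ)

section Logit

/-- The logit map, sending a vector of scores to the joint strategy proportional to their
exponentials. -/
noncomputable def logit (y : Profile S) : Profile S :=
  fun k i => Real.exp (y k i) / ∑ j, Real.exp (y k j)

theorem logit_log {x : Profile S} (hx : x ∈ interiorStrategies S) :
    logit (fun k i => Real.log (x k i)) = x := by
  funext k i
  simp [logit, Real.exp_log (hx.2 k _), (hx.1 k).2]

variable [∀ k, Nonempty (S k)]

theorem sum_exp_pos (y : Profile S) (k : V) : 0 < ∑ j, Real.exp (y k j) :=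
  Finset.sum_pos (fun _ _ => Real.exp_pos _) Finset.univ_nonempty

theorem logit_mem_interiorStrategies (y : Profile S) : logit y ∈ interiorStrategies S := by
  have hpos : ∀ k i, 0 < logit y k i := fun k i => div_pos (Real.exp_pos _) (sum_exp_pos y k)
  refine ⟨fun k => ⟨fun i => (hpos k i).le, ?_⟩, hpos⟩
  simp only [logit]
  rw [← Finset.sum_div, div_self (sum_exp_pos y k).ne']

theorem log_logit (y : Profile S) (k : V) (i : S k) :
    Real.log (logit y k i) = y k i - Real.log (∑ j, Real.exp (y k j)) := by
  rw [logit, Real.log_div (Real.exp_pos _).ne' (sum_exp_pos y k).ne', Real.log_exp]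

end Logit

variable [Fintype V]

theorem reward_add (Γ : NetworkGame V S) (x y : Profile S) :
    Γ.reward (x + y) = Γ.reward x + Γ.reward y := by
  funext k i
  simp [reward, Matrix.mulVec_add, Finset.sum_add_distrib]

theorem reward_smul (Γ : NetworkGame V S) (c : ℝ) (x : Profile S) :
    Γ.reward (c • x) = c • Γ.reward x := by
  funext k i
  simp [reward, Matrix.mulVec_smul, Finset.mul_sum]

/-- The reward as a continuous linear map of the joint strategy. -/
noncomputable def rewardCLM (Γ : NetworkGame V S) : Profile S →L[ℝ] Profile S :=
  LinearMap.toContinuousLinearMap ⟨⟨Γ.reward, Γ.reward_add⟩, Γ.reward_smul⟩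

/-- Swapping the two ends of each edge replaces `A k l` by the transpose of `A l k`, which is `-A k
l`. -/
theorem IsPairwiseZeroSum.sum_dotProduct_reward {Γ : NetworkGame V S} (hΓ : Γ.IsPairwiseZeroSum)
    (x y : Profile S) :
    ∑ k, x k ⬝ᵥ Γ.reward y k = - ∑ k, y k ⬝ᵥ Γ.reward x k := by
  classical
  have h : ∀ x y : Profile S, ∑ k, x k ⬝ᵥ Γ.reward y k
      = ∑ k, ∑ l, if Γ.graph.Adj k l then x k ⬝ᵥ (Γ.A k l *ᵥ y l) else 0 := by
    intro x y
    refine Finset.sum_congr rfl fun k _ => ?_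
    rw [← Finset.sum_filter]
    simp only [reward, dotProduct, Finset.mul_sum]
    rw [Finset.sum_comm]
  rw [h, h, Finset.sum_comm, ← Finset.sum_neg_distrib]
  refine Finset.sum_congr rfl fun l _ => ?_
  rw [← Finset.sum_neg_distrib]
  refine Finset.sum_congr rfl fun k _ => ?_
  by_cases hkl : Γ.graph.Adj k l
  · rw [if_pos hkl, if_pos hkl.symm, eq_neg_of_add_eq_zero_left (hΓ k l hkl), Matrix.neg_mulVec,
      dotProduct_neg, Matrix.mulVec_transpose, dotProduct_comm, Matrix.dotProduct_mulVec]
  · rw [if_neg hkl, if_neg fun h => hkl h.symm, neg_zero]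

theorem IsPairwiseZeroSum.sum_dotProduct_reward_self {Γ : NetworkGame V S}
    (hΓ : Γ.IsPairwiseZeroSum) (x : Profile S) : ∑ k, x k ⬝ᵥ Γ.reward x k = 0 := by
  linarith [hΓ.sum_dotProduct_reward x x]

variable [∀ k, Nonempty (S k)]

theorem contDiff_logit : ContDiff ℝ 1 (logit : Profile S → Profile S) := by
  refine contDiff_pi.2 fun k => contDiff_pi.2 fun i => ?_
  have hexp : ∀ j : S k, ContDiff ℝ 1 fun y : Profile S => Real.exp (y k j) := fun j =>
    (contDiff_pi.1 (contDiff_pi.1 contDiff_id k) j).exp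
  exact (hexp i).div (ContDiff.sum fun j _ => hexp j) fun y => (sum_exp_pos y k).ne'

theorem isQRE_iff (Γ : NetworkGame V S) (T : V → ℝ) (x : Profile S) :
    Γ.IsQRE T x ↔ x = logit fun k i => Γ.reward x k i / T k := by
  refine ⟨fun h => funext fun k => funext fun i => h.2 k i, fun h => ⟨?_, fun k i => ?_⟩⟩
  · rw [h]; exact (logit_mem_interiorStrategies _).1
  · exact congrFun (congrFun h k) i

theorem IsQRE.mem_interiorStrategies {Γ : NetworkGame V S} {T : V → ℝ} {x : Profile S}
    (h : Γ.IsQRE T x) : x ∈ interiorStrategies S := by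
  rw [(Γ.isQRE_iff T x).1 h]; exact logit_mem_interiorStrategies _

/-- The rewards at a quantal response, up to a constant for each player. -/
theorem dotProduct_reward_eq (Γ : NetworkGame V S) {T : V → ℝ} (hT : ∀ k, 0 < T k)
    (x : Profile S) {w : Profile S} (hw : w ∈ strategies S) (k : V) :
    w k ⬝ᵥ Γ.reward x k
      = T k * ∑ i, w k i * Real.log (logit (fun k i => Γ.reward x k i / T k) k i)
        + T k * Real.log (∑ j, Real.exp (Γ.reward x k j / T k)) := by
  have h1 : ∀ i, T k * (w k i * Real.log (logit (fun k i => Γ.reward x k i / T k) k i))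
      = w k i * Γ.reward x k i
        - w k i * (T k * Real.log (∑ j, Real.exp (Γ.reward x k j / T k))) := by
    intro i
    rw [log_logit]
    have := (hT k).ne'
    field_simp
  rw [Finset.mul_sum, Finset.sum_congr rfl fun i _ => h1 i, Finset.sum_sub_distrib,
    ← Finset.sum_mul, (hw k).2]
  simp [dotProduct]

end NetworkGame

/-! ### The entropy regularized game and existence of a QRE -/

namespace NetworkGame

section Entropy

variable {V : Type*} [Fintype V] {S : V → Type*} [∀ k, Fintype (S k)]

/-- The negative entropy of a joint strategy, weighted by the exploration rates. -/
noncomputable def negEntropy (T : V → ℝ) (x : Profile S) : ℝ :=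
  ∑ k, T k * ∑ i, x k i * Real.log (x k i)

theorem continuous_negEntropy (T : V → ℝ) : Continuous (negEntropy T : Profile S → ℝ) := by
  refine continuous_finsetSum _ fun k _ => continuous_const.mul
    (continuous_finsetSum _ fun i _ => ?_)
  exact Real.continuous_mul_log.comp ((continuous_apply i).comp (continuous_apply k))

theorem convexOn_negEntropy {T : V → ℝ} (hT : ∀ k, 0 < T k) :
    ConvexOn ℝ (strategies S) (negEntropy T) := by
  refine ⟨convex_strategies, fun x hx y hy a b ha hb hab => ?_⟩
  have h : ∀ k i, (a • x + b • y) k i * Real.log ((a • x + b • y) k i)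
      ≤ a * (x k i * Real.log (x k i)) + b * (y k i * Real.log (y k i)) := fun k i =>
    Real.convexOn_mul_log.2 ((hx k).1 i) ((hy k).1 i) ha hb hab
  calc negEntropy T (a • x + b • y)
      ≤ ∑ k, T k * ∑ i, (a * (x k i * Real.log (x k i)) + b * (y k i * Real.log (y k i))) :=
        Finset.sum_le_sum fun k _ => mul_le_mul_of_nonneg_left
          (Finset.sum_le_sum fun i _ => h k i) (hT k).le
    _ = a • negEntropy T x + b • negEntropy T y := by
        simp only [negEntropy, smul_eq_mul, Finset.mul_sum, ← Finset.sum_add_distrib]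
        exact Finset.sum_congr rfl fun k _ => Finset.sum_congr rfl fun i _ => by ring

theorem continuous_sum_dotProduct (v : Profile S) :
    Continuous fun x : Profile S => ∑ k, v k ⬝ᵥ x k :=
  continuous_finsetSum _ fun k _ => continuous_const.dotProduct (continuous_apply k)

theorem convexOn_sum_dotProduct_reward (Γ : NetworkGame V S) (v : Profile S) :
    ConvexOn ℝ (strategies S) fun x => ∑ k, v k ⬝ᵥ Γ.reward x k :=
  ⟨convex_strategies, fun x _ y _ a b _ _ _ => le_of_eq (by
    simp [reward_add, reward_smul, dotProduct_add, dotProduct_smul, Finset.sum_add_distrib,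
      Finset.mul_sum])⟩

/-- A symmetric zero-sum reformulation of the logit equilibrium problem: there is a strategy
against which no strategy gains in the entropy regularized game. -/
theorem IsPairwiseZeroSum.exists_regularized_equilibrium {Γ : NetworkGame V S}
    [∀ k, Nonempty (S k)] (hΓ : Γ.IsPairwiseZeroSum) {T : V → ℝ} (hT : ∀ k, 0 < T k) :
    ∃ a ∈ strategies S, ∀ v ∈ strategies S,
      ∑ k, v k ⬝ᵥ Γ.reward a k + negEntropy T a - negEntropy T v ≤ 0 := by
  set f : Profile S → Profile S → ℝ :=
    fun x v => ∑ k, v k ⬝ᵥ Γ.reward x k + negEntropy T x - negEntropy T v with hf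
  -- Antisymmetry transfers continuity and convexity in the first argument to continuity and
  -- concavity in the second.
  have hneg : ∀ x v, f x v = - f v x := fun x v => by
    simp only [hf, hΓ.sum_dotProduct_reward v x]; ring
  have hcont : ∀ v, Continuous fun x => f x v := fun v =>
    (((continuous_sum_dotProduct v).comp Γ.rewardCLM.continuous).add
      (continuous_negEntropy T)).sub continuous_const
  have hconv : ∀ v, ConvexOn ℝ (strategies S) fun x => f x v := fun v =>
    ((Γ.convexOn_sum_dotProduct_reward v).add (convexOn_negEntropy hT)).add_const
      (-negEntropy T v)
  have hne : (strategies S).Nonempty := ⟨_, (logit_mem_interiorStrategies 0).1⟩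
  obtain ⟨a, ha, b, hb, hab⟩ := Sion.exists_isSaddlePointOn' (f := f) hne isCompact_strategies
    (fun v _ => (hcont v).continuousOn.lowerSemicontinuousOn)
    (fun v _ => (hconv v).quasiconvexOn) convex_strategies isCompact_strategies
    (fun x _ => by
      have : f x = fun v => - f v x := funext (hneg x)
      rw [this]
      exact (hcont x).neg.continuousOn.upperSemicontinuousOn)
    (fun x _ => by
      have : f x = fun v => - f v x := funext (hneg x)
      rw [this]
      exact (hconv x).neg.quasiconcaveOn) convex_strategies hne
  refine ⟨a, ha, fun v hv => ?_⟩
  -- The saddle inequality gives `f a v ≤ f b b`, and `f b b = 0` by antisymmetry.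
  have h1 := hab b hb v hv
  have h2 := hneg b b
  change f a v ≤ 0
  linarith

end Entropy

variable {V : Type*} [Fintype V] {S : V → Type*} [∀ k, Fintype (S k)]

/-- In the interior, the field involves logarithms of single entries only. -/
theorem qLearningField_eq (Γ : NetworkGame V S) (T : V → ℝ) {x : Profile S}
    (hx : x ∈ interiorStrategies S) (k : V) (i : S k) :
    Γ.qLearningField T x k i = x k i * (Γ.reward x k i - x k ⬝ᵥ Γ.reward x k
      + T k * (∑ j, x k j * Real.log (x k j) - Real.log (x k i))) := by
  have h : ∀ j, x k j * Real.log (x k j / x k i)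
      = x k j * Real.log (x k j) - x k j * Real.log (x k i) := fun j => by
    rw [Real.log_div (hx.2 k j).ne' (hx.2 k i).ne', mul_sub]
  rw [qLearningField, Finset.sum_congr rfl fun j _ => h j, Finset.sum_sub_distrib,
    ← Finset.sum_mul, (hx.1 k).2, one_mul]

theorem IsQLearningTrajectory.hasDerivWithinAt_relEntropy {Γ : NetworkGame V S} {T : V → ℝ}
    {x : ℝ → Profile S} (hx : Γ.IsQLearningTrajectory T x) (z : Profile S) {t : ℝ} (ht : 0 ≤ t) :
    HasDerivWithinAt (fun s => ∑ k, relEntropy (z k) (x s k))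
      (- ∑ k, ∑ i, z k i * (Γ.qLearningField T (x t) k i / x t k i)) (Set.Ici 0) t := by
  rw [← Finset.sum_neg_distrib]
  refine HasDerivWithinAt.fun_sum fun k _ => ?_
  rw [← Finset.sum_neg_distrib]
  refine HasDerivWithinAt.fun_sum fun i _ => ?_
  have h := (hasDerivWithinAt_pi.1 (hasDerivWithinAt_pi.1 (hx.2 t ht) k) i).log
    ((hx.1 t ht).2 k i).ne'
  exact ((h.const_sub (Real.log (z k i))).const_mul (z k i)).congr_deriv (by ring)

variable [∀ k, Nonempty (S k)]

theorem IsPairwiseZeroSum.exists_isQRE {Γ : NetworkGame V S} (hΓ : Γ.IsPairwiseZeroSum)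
    {T : V → ℝ} (hT : ∀ k, 0 < T k) : ∃ z, Γ.IsQRE T z := by
  obtain ⟨a, ha, hmax⟩ := hΓ.exists_regularized_equilibrium hT
  refine ⟨a, (Γ.isQRE_iff T a).2 ?_⟩
  set b := logit fun k i => Γ.reward a k i / T k with hb
  have hbi : b ∈ interiorStrategies S := logit_mem_interiorStrategies _
  -- The gain of the logit response `b` against `a` is exactly this sum: the entropy of `b` cancels,
  -- and the log-normalizers are eliminated by the vanishing of the total payoff at `a`.
  have hsum : ∑ k, T k * relEntropy (a k) (b k) ≤ 0 := by
    refine le_trans (le_of_eq ?_) (hmax b hbi.1)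
    have h0 := hΓ.sum_dotProduct_reward_self a
    simp only [Γ.dotProduct_reward_eq hT a ha] at h0
    simp only [Γ.dotProduct_reward_eq hT a hbi.1, negEntropy, relEntropy_eq_sub, mul_sub,
      Finset.sum_sub_distrib, Finset.sum_add_distrib, ← hb] at h0 ⊢
    linarith
  have hnn : ∀ k, 0 ≤ T k * relEntropy (a k) (b k) := fun k =>
    mul_nonneg (hT k).le (relEntropy_nonneg (ha k) (hbi.1 k) (hbi.2 k))
  have hz := (Finset.sum_eq_zero_iff_of_nonneg fun k _ => hnn k).1
    (le_antisymm hsum (Finset.sum_nonneg fun k _ => hnn k))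
  funext k i
  have hk : relEntropy (a k) (b k) = 0 :=
    (mul_eq_zero.1 (hz k (Finset.mem_univ k))).resolve_left (hT k).ne'
  have hs := sum_sq_sqrt_sub_sqrt_le_relEntropy (ha k) (hbi.1 k) (hbi.2 k)
  have hi := Finset.single_le_sum (f := fun i => (√(a k i) - √(b k i)) ^ 2)
    (fun i _ => sq_nonneg _) (Finset.mem_univ i)
  have h0 : (√(a k i) - √(b k i)) ^ 2 = 0 := le_antisymm (by simpa [hk] using hi.trans hs)
    (sq_nonneg _)
  exact (Real.sqrt_inj ((ha k).1 i) (hbi.2 k i).le).1 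
    (sub_eq_zero.1 (pow_eq_zero_iff two_ne_zero |>.1 h0))

/-! ### Global existence of trajectories -/

/-- In score coordinates `x = logit y` the Q-learning dynamics are `ẏ = r(x) - T y`. -/
theorem hasDerivAt_logit (Γ : NetworkGame V S) (T : V → ℝ) {y : ℝ → Profile S} {t : ℝ}
    (hy : HasDerivAt y (fun k i => Γ.reward (logit (y t)) k i - T k * y t k i) t) :
    HasDerivAt (fun s => logit (y s)) (Γ.qLearningField T (logit (y t))) t := by
  have hx := logit_mem_interiorStrategies (y t)
  refine hasDerivAt_pi.2 fun k => hasDerivAt_pi.2 fun i => ?_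
  have hexp : ∀ j, HasDerivAt (fun s => Real.exp (y s k j))
      (Real.exp (y t k j) * (Γ.reward (logit (y t)) k j - T k * y t k j)) t := fun j =>
    (hasDerivAt_pi.1 (hasDerivAt_pi.1 hy k) j).exp
  have hZ := (sum_exp_pos (y t) k).ne'
  have hd := (hexp i).fun_div (HasDerivAt.fun_sum fun j (_ : j ∈ Finset.univ) => hexp j) hZ
  refine hd.congr_deriv ?_
  have h1 : ∀ j, Real.exp (y t k j) = logit (y t) k j * ∑ j, Real.exp (y t k j) := fun j => by
    rw [logit, div_mul_cancel₀ _ hZ]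
  have h2 : ∑ j, Real.exp (y t k j) * (Γ.reward (logit (y t)) k j - T k * y t k j)
      = (logit (y t) k ⬝ᵥ Γ.reward (logit (y t)) k - T k * ∑ j, logit (y t) k j * y t k j)
        * ∑ j, Real.exp (y t k j) := by
    rw [dotProduct, Finset.mul_sum (a := T k), ← Finset.sum_sub_distrib, Finset.sum_mul]
    refine Finset.sum_congr rfl fun j _ => ?_
    rw [h1 j]; ring
  -- The log-normalizer appears here and in `log_logit` with the same coefficient, so it drops out
  -- of the field.
  have h3 : ∑ j, logit (y t) k j * Real.log (logit (y t) k j)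
      = ∑ j, logit (y t) k j * y t k j - Real.log (∑ j, Real.exp (y t k j)) := by
    simp only [log_logit, mul_sub, Finset.sum_sub_distrib, ← Finset.sum_mul, (hx.1 k).2, one_mul]
  rw [Γ.qLearningField_eq T hx, h3, log_logit, h2, h1 i]
  field_simp
  ring

/-- Passing to scores removes the logarithmic singularity at the boundary and keeps entries positive
automatically. Rewards are bounded on the compact strategy set, so the score field grows at most
linearly. -/
theorem exists_isQLearningTrajectory (Γ : NetworkGame V S) (T : V → ℝ) {x₀ : Profile S}
    (hx₀ : x₀ ∈ interiorStrategies S) : ∃ x, Γ.IsQLearningTrajectory T x ∧ x 0 = x₀ := by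
  let F : Profile S → Profile S := fun y k i => Γ.reward (logit y) k i - T k * y k i
  have hcoord : ∀ k (i : S k), ContDiff ℝ 1 fun y : Profile S => y k i := fun k i =>
    contDiff_pi.1 (contDiff_pi.1 contDiff_id k) i
  have hF : ContDiff ℝ 1 F := contDiff_pi.2 fun k => contDiff_pi.2 fun i =>
    ((hcoord k i).comp (Γ.rewardCLM.contDiff.comp contDiff_logit)).sub
      (contDiff_const.mul (hcoord k i))
  obtain ⟨C, hC⟩ := (isCompact_strategies (S := S)).exists_bound_of_continuousOn
    Γ.rewardCLM.continuous.continuousOn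
  have hC' : ∀ y, ‖Γ.reward (logit y)‖ ≤ C := fun y =>
    hC _ (logit_mem_interiorStrategies y).1
  have hb : ∀ y, ‖F y‖ ≤ C + ‖T‖ * ‖y‖ := by
    intro y
    have hC0 := (norm_nonneg _).trans (hC' y)
    have hR : 0 ≤ C + ‖T‖ * ‖y‖ := by positivity
    refine (pi_norm_le_iff_of_nonneg hR).2 fun k => (pi_norm_le_iff_of_nonneg hR).2 fun i => ?_
    refine (norm_sub_le _ _).trans (add_le_add ?_ ?_)
    · exact (norm_le_pi_norm (Γ.reward (logit y) k) i).trans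
        ((norm_le_pi_norm (Γ.reward (logit y)) k).trans (hC' y))
    · rw [norm_mul]
      exact mul_le_mul (norm_le_pi_norm T k)
        ((norm_le_pi_norm (y k) i).trans (norm_le_pi_norm y k)) (norm_nonneg _) (norm_nonneg _)
  obtain ⟨y, hy0, hy⟩ := exists_isIntegralCurve_of_norm_le hF
    ((norm_nonneg _).trans (hC' 0)) (norm_nonneg T) hb fun k i => Real.log (x₀ k i)
  refine ⟨fun t => logit (y t), ⟨fun t _ => logit_mem_interiorStrategies _, fun t _ => ?_⟩, ?_⟩
  · exact (Γ.hasDerivAt_logit T (hy t)).hasDerivWithinAt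
  · simp only [hy0]
    exact logit_log hx₀

/-! ### Lyapunov argument and convergence -/

/-- Quantal response equilibria are rest points of the Q-learning dynamics. -/
theorem IsQRE.qLearningField_eq_zero {Γ : NetworkGame V S} {T : V → ℝ} (hT : ∀ k, 0 < T k)
    {z : Profile S} (hz : Γ.IsQRE T z) : Γ.qLearningField T z = 0 := by
  funext k i
  have hzi := hz.mem_interiorStrategies
  have hzl := (Γ.isQRE_iff T z).1 hz
  have h1 := Γ.dotProduct_reward_eq hT z hzi.1 k
  have h2 := log_logit (fun k i => Γ.reward z k i / T k) k i
  rw [← hzl] at h1 h2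
  have h3 : Γ.reward z k i = T k * (Γ.reward z k i / T k) := by
    rw [mul_div_cancel₀ _ (hT k).ne']
  rw [Γ.qLearningField_eq T hzi, h1, h2, h3]
  simp only [Pi.zero_apply]
  rw [mul_div_cancel_left₀ _ (hT k).ne']
  ring

theorem IsQRE.isQLearningTrajectory_const {Γ : NetworkGame V S} {T : V → ℝ}
    (hT : ∀ k, 0 < T k) {z : Profile S} (hz : Γ.IsQRE T z) :
    Γ.IsQLearningTrajectory T fun _ => z := by
  refine ⟨fun _ _ => hz.mem_interiorStrategies, fun t _ => ?_⟩
  simp only [hz.qLearningField_eq_zero hT]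
  exact hasDerivWithinAt_const _ _ _

/-- The rate at which the relative entropy with respect to an equilibrium decreases. -/
theorem IsPairwiseZeroSum.sum_dotProduct_qLearningField {Γ : NetworkGame V S}
    (hΓ : Γ.IsPairwiseZeroSum) {T : V → ℝ} (hT : ∀ k, 0 < T k) {z x : Profile S}
    (hz : Γ.IsQRE T z) (hx : x ∈ interiorStrategies S) :
    ∑ k, ∑ i, z k i * (Γ.qLearningField T x k i / x k i)
      = ∑ k, T k * (relEntropy (z k) (x k) + relEntropy (x k) (z k)) := by
  have hzi := hz.mem_interiorStrategies
  have hzl := (Γ.isQRE_iff T z).1 hz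
  have h1 : ∀ k, ∑ i, z k i * (Γ.qLearningField T x k i / x k i)
      = z k ⬝ᵥ Γ.reward x k - x k ⬝ᵥ Γ.reward x k
        + (T k * ∑ j, x k j * Real.log (x k j) - T k * ∑ i, z k i * Real.log (x k i)) := by
    intro k
    have h : ∀ i, z k i * (Γ.qLearningField T x k i / x k i)
        = z k i * Γ.reward x k i - z k i * (x k ⬝ᵥ Γ.reward x k)
          + (z k i * (T k * ∑ j, x k j * Real.log (x k j))
            - T k * (z k i * Real.log (x k i))) := fun i => by
      rw [Γ.qLearningField_eq T hx, mul_div_cancel_left₀ _ (hx.2 k i).ne']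
      ring
    rw [Finset.sum_congr rfl fun i _ => h i, Finset.sum_add_distrib, Finset.sum_sub_distrib,
      Finset.sum_sub_distrib, ← Finset.sum_mul, ← Finset.sum_mul, (hzi.1 k).2, one_mul, one_mul,
      ← Finset.mul_sum]
    rfl
  -- The unknown rewards at `x` are traded for those at `z`, which are logarithms of `z` up to
  -- normalizers; `hzz` eliminates the normalizers.
  have hxx := hΓ.sum_dotProduct_reward_self x
  have hzz := hΓ.sum_dotProduct_reward_self z
  have hzx := hΓ.sum_dotProduct_reward z x
  simp only [Γ.dotProduct_reward_eq hT z hzi.1, Γ.dotProduct_reward_eq hT z hx.1, ← hzl,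
    Finset.sum_add_distrib] at hzz hzx
  simp only [h1, relEntropy_eq_sub, mul_add, mul_sub, Finset.sum_add_distrib,
    Finset.sum_sub_distrib]
  linarith

/-- The rate `c` is a lower bound for the exploration rates. Discarding the reverse relative entropy
leaves `D' ≤ -c * D`, integrated with the factor `exp (c * s)`. -/
theorem IsPairwiseZeroSum.exists_relEntropy_le {Γ : NetworkGame V S}
    (hΓ : Γ.IsPairwiseZeroSum) {T : V → ℝ} (hT : ∀ k, 0 < T k) {z : Profile S}
    (hz : Γ.IsQRE T z) :
    ∃ c > 0, ∀ x, Γ.IsQLearningTrajectory T x → ∀ t, 0 ≤ t →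
      ∑ k, relEntropy (z k) (x t k) ≤ Real.exp (-(c * t)) * ∑ k, relEntropy (z k) (x 0 k) := by
  have hzi := hz.mem_interiorStrategies
  obtain ⟨c, hc, hcT⟩ : ∃ c > 0, ∀ k, c ≤ T k := by
    cases isEmpty_or_nonempty V
    · exact ⟨1, one_pos, fun k => isEmptyElim k⟩
    · obtain ⟨k, hk⟩ := Finite.exists_min T
      exact ⟨T k, hT k, hk⟩
  refine ⟨c, hc, fun x hx t ht => ?_⟩
  set D : ℝ → ℝ := fun s => ∑ k, relEntropy (z k) (x s k) with hD
  have hder : ∀ s, 0 ≤ s → HasDerivWithinAt (fun s => Real.exp (c * s) * D s)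
      (Real.exp (c * s) * (c * D s
        - ∑ k, ∑ i, z k i * (Γ.qLearningField T (x s) k i / x s k i))) (Set.Ici 0) s := by
    intro s hs
    have he : HasDerivWithinAt (fun s => Real.exp (c * s)) (Real.exp (c * s) * c)
        (Set.Ici 0) s := by
      simpa using ((hasDerivAt_id s).const_mul c).exp.hasDerivWithinAt
    exact (he.mul (hx.hasDerivWithinAt_relEntropy z hs)).congr_deriv (by ring)
  have hanti : AntitoneOn (fun s => Real.exp (c * s) * D s) (Set.Ici 0) := by
    refine antitoneOn_of_hasDerivWithinAt_nonpos (convex_Ici 0)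
      (fun s hs => (hder s hs).continuousWithinAt)
      (fun s hs => (hder s (interior_subset hs)).mono interior_subset) fun s hs => ?_
    have hxs := hx.1 s (interior_subset hs)
    refine mul_nonpos_of_nonneg_of_nonpos (Real.exp_pos _).le (sub_nonpos.2 ?_)
    rw [hΓ.sum_dotProduct_qLearningField hT hz hxs, hD, Finset.mul_sum]
    refine Finset.sum_le_sum fun k _ => ?_
    have h1 := relEntropy_nonneg (hzi.1 k) (hxs.1 k) (hxs.2 k)
    have h2 := relEntropy_nonneg (hxs.1 k) (hzi.1 k) (hzi.2 k)
    exact mul_le_mul (hcT k) (le_add_of_nonneg_right h2) h1 (hT k).le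
  have h := hanti Set.self_mem_Ici ht ht
  simp only [mul_zero, Real.exp_zero, one_mul] at h
  rw [Real.exp_neg, ← div_eq_inv_mul, le_div_iff₀ (Real.exp_pos _), mul_comm]
  exact h

theorem IsPairwiseZeroSum.tendsto_of_isQRE {Γ : NetworkGame V S}
    (hΓ : Γ.IsPairwiseZeroSum) {T : V → ℝ} (hT : ∀ k, 0 < T k) {z : Profile S}
    (hz : Γ.IsQRE T z) {x : ℝ → Profile S} (hx : Γ.IsQLearningTrajectory T x) :
    Filter.Tendsto x Filter.atTop (𝓝 z) := by
  have hzi := hz.mem_interiorStrategies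
  obtain ⟨c, hc, hle⟩ := hΓ.exists_relEntropy_le hT hz
  have hlim : Filter.Tendsto
      (fun t => Real.exp (-(c * t)) * ∑ k, relEntropy (z k) (x 0 k)) Filter.atTop (𝓝 0) := by
    simpa using (Real.tendsto_exp_neg_atTop_nhds_zero.comp
      (Filter.tendsto_id.const_mul_atTop hc)).mul_const (∑ k, relEntropy (z k) (x 0 k))
  refine tendsto_pi_nhds.2 fun k => tendsto_pi_nhds.2 fun i => ?_
  have hsq : Filter.Tendsto (fun t => (√(z k i) - √(x t k i)) ^ 2) Filter.atTop (𝓝 0) := by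
    refine tendsto_of_tendsto_of_tendsto_of_le_of_le' tendsto_const_nhds hlim
      (Filter.Eventually.of_forall fun t => sq_nonneg _) ?_
    filter_upwards [Filter.eventually_ge_atTop 0] with t ht
    have hxt := hx.1 t ht
    calc (√(z k i) - √(x t k i)) ^ 2
        ≤ ∑ i, (√(z k i) - √(x t k i)) ^ 2 :=
          Finset.single_le_sum (f := fun i => (√(z k i) - √(x t k i)) ^ 2)
            (fun i _ => sq_nonneg _) (Finset.mem_univ i)
      _ ≤ relEntropy (z k) (x t k) :=
          sum_sq_sqrt_sub_sqrt_le_relEntropy (hzi.1 k) (hxt.1 k) (hxt.2 k)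
      _ ≤ ∑ k, relEntropy (z k) (x t k) :=
          Finset.single_le_sum (f := fun k => relEntropy (z k) (x t k))
            (fun k _ => relEntropy_nonneg (hzi.1 k) (hxt.1 k) (hxt.2 k)) (Finset.mem_univ k)
      _ ≤ _ := hle x hx t ht
  have habs : Filter.Tendsto (fun t => √(z k i) - √(x t k i)) Filter.atTop (𝓝 0) := by
    rw [tendsto_zero_iff_abs_tendsto_zero]
    simpa [Function.comp_def, Real.sqrt_sq_eq_abs] using (Real.continuous_sqrt.tendsto 0).comp hsq
  have hsqrt : Filter.Tendsto (fun t => √(x t k i)) Filter.atTop (𝓝 (√(z k i))) := by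
    simpa using habs.const_sub (√(z k i))
  have := hsqrt.pow 2
  rw [Real.sq_sqrt (hzi.2 k i).le] at this
  refine this.congr' ?_
  filter_upwards [Filter.eventually_ge_atTop 0] with t ht
  exact Real.sq_sqrt ((hx.1 t ht).2 k i).le

end NetworkGame

theorem corollary1 {V : Type*} [Fintype V] {S : V → Type*} [∀ k, Fintype (S k)]
    [∀ k, Nonempty (S k)] (Γ : NetworkGame V S) (hΓ : Γ.IsPairwiseZeroSum) :
    Γ.interactionCoefficient = 0 ∧
      ∀ T : V → ℝ, (∀ k, 0 < T k) →
        ∃ z : NetworkGame.Profile S, Γ.IsQRE T z ∧ (∀ y, Γ.IsQRE T y → y = z) ∧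
          Γ.QLearningConvergesTo T z := by
  refine ⟨hΓ.interactionCoefficient_eq_zero, fun T hT => ?_⟩
  obtain ⟨z, hz⟩ := hΓ.exists_isQRE hT
  exact ⟨z, hz,
    -- The constant trajectory at another QRE `y` must also tend to `z`.
    fun y hy => tendsto_nhds_unique tendsto_const_nhds
      (hΓ.tendsto_of_isQRE hT hz (hy.isQLearningTrajectory_const hT)),
    fun x₀ hx₀ => Γ.exists_isQLearningTrajectory T hx₀,
    fun x hx => hΓ.tendsto_of_isQRE hT hz hx⟩
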